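/- Let $q\colon\mathbb{R}\to\mathbb{R}$ be a nonnegative function in $L^1(\mathbb{R})\cap L^2(\mathbb{R})$ and let $R\colon\mathbb{R}\times\mathbb{R}\to\mathbb{C}$ be continuous and positive definite, that is, $\sum_{i,j=1}^n \overline{c_i}\,R(x_i,x_j)\,c_j\ge 0$ for all $n\ge1$, $x_1,\dots,x_n\in\mathbb{R}$ and $c_1,\dots,c_n\in\mathbb{C}$ (so that $R(x,x)\ge0$). Suppose that $$\int_{\mathbb{R}} q(x)R(x,x)\,dx<\infty .$$ Then the formula $$(Kf)(s)=\int_{\mathbb{R}} q(s)^{1/2}R(s,t)q(t)^{1/2}f(t)\,dt$$ (where, for each $f\in L^2(\mathbb{R})$, the integral converges absolutely for almost every $s$) defines a bounded operator $K$ on the complex Hilbert space $L^2(\mathbb{R})$, which is nonnegative and of trace class, and its trace norm $\|K\|_{\boldsymbol{S}_1}=\operatorname{trace}\big((K^*K)^{1/2}\big)$ satisfies $$\|K\|_{\boldsymbol{S}_1}=\operatorname{trace}K=\int_{\mathbb{R}} q(x)R(x,x)\,dx<\infty .$$ -/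

import Mathlib

open MeasureTheory
open scoped ENNReal InnerProductSpace ComplexOrder

/-- A kernel `R` on `X × X` is positive definite (in the sense usual for kernels):
`∑ i j, conj (c i) * R (x i) (x j) * c j ≥ 0` for all finitely many points `x i` and complex
numbers `c i`. This is Mathlib's positive semidefiniteness of `R` as a possibly infinite matrix. -/
def IsPositiveDefiniteKernel {X : Type*} (R : X → X → ℂ) : Prop :=
  Matrix.PosSemidef (Matrix.of R)

/-- `K` is the integral operator with kernel `k` on `L²(μ)`: for each `f` and almost every `s` the
integral `∫ k s t * f t` converges absolutely and is equal to `(K f) s`. -/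
def IsIntegralOperator {X : Type*} [MeasurableSpace X] {μ : Measure X} (k : X → X → ℂ)
    (K : Lp ℂ 2 μ →L[ℂ] Lp ℂ 2 μ) : Prop :=
  ∀ f : Lp ℂ 2 μ, ∀ᵐ s ∂μ, Integrable (fun t => k s t * f t) μ ∧ K f s = ∫ t, k s t * f t ∂μ

section TraceClass

variable {H : Type*} [NormedAddCommGroup H] [InnerProductSpace ℂ H] [CompleteSpace H]

/-- The trace norm `trace |T| ∈ [0, ∞]`, where `|T| = (T* T)^(1/2)`. The sum of the nonnegative
numbers `⟪e, |T| e⟫` over an orthonormal basis does not depend on the basis; the supremum over all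
bases avoids a choice. A basis is indexed by a set of vectors, which only fixes its labels. -/
noncomputable def traceNorm (T : H →L[ℂ] H) : ℝ≥0∞ :=
  ⨆ (w : Set H) (b : HilbertBasis w ℂ H), ∑' i, ENNReal.ofReal (⟪b i, CFC.abs T (b i)⟫_ℂ).re

/-- `T` is of trace class if its trace norm is finite. -/
def IsTraceClass (T : H →L[ℂ] H) : Prop :=
  traceNorm T < ∞

/-- The trace of `T` is `a`: in every orthonormal basis, the sum of the `⟪e, T e⟫` converges
(unconditionally) to `a`. There is a basis, so `a` is unique. -/
def HasTrace (T : H →L[ℂ] H) (a : ℂ) : Prop :=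
  ∀ (w : Set H) (b : HilbertBasis w ℂ H), HasSum (fun i => ⟪b i, T (b i)⟫_ℂ) a

end TraceClass

/-!
A positive definite kernel is a Gram kernel: `R x y = ⟪φ x, φ y⟫` for vectors `φ x` of the
reproducing kernel Hilbert space `H` of `R` (`IsPositiveDefiniteKernel.exists_featureMap`). Since
`R` is continuous, so is `φ`, and since the `φ x` span a dense subspace, `H` is separable. The
vectors `g s = √(q s) • φ s` satisfy `‖g s‖² = q s * R s s` for almost every `s` (where `0 ≤ q s`), so
`g` is square integrable because `q x * R x x` is integrable.

Let `A : H → L²` be the operator `(A h) s = ⟪g s, h⟫` (`analysisOperator`). Then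
`(A A* f) s = ⟪g s, A* f⟫ = ⟪A (g s), f⟫ = ∫ t, ⟪g s, g t⟫ * f t`, so the required operator is
`K = A A*`, which is nonnegative; no Bochner integral in `H` is needed. Because `K` is nonnegative,
`|K| = K`, and in an orthonormal basis `e` of `L²` both the trace and the trace norm are
`∑ i, ⟪e i, K (e i)⟫ = ∑ i, ‖A* (e i)‖²`. By Parseval's identity this is `∑ j, ‖A (h j)‖²` for a
countable orthonormal basis `h` of `H`, that is `∑ j, ∫ s, |⟪h j, g s⟫|²`; exchanging sum and
integral and using Parseval's identity in `H` turns it into `∫ s, ‖g s‖² = ∫ s, q s * R s s`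
(`tsum_enorm_adjoint_analysisOperator_sq`).
-/

/-! ### Orthonormal bases -/

/-- Any two distinct vectors of an orthonormal family are at distance `√2`, so an orthonormal family
in a separable space is countable. -/
theorem Orthonormal.countable_of_separableSpace {H ι : Type*} [NormedAddCommGroup H]
    [InnerProductSpace ℂ H] [TopologicalSpace.SeparableSpace H] {v : ι → H}
    (hv : Orthonormal ℂ v) : Countable ι := by
  have hdist : ∀ i j, i ≠ j → 1 ≤ dist (v i) (v j) := by
    intro i j hij
    have h := @norm_sub_sq ℂ H _ _ _ (v i) (v j)
    rw [hv.1 i, hv.1 j, hv.2 hij] at h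
    rw [dist_eq_norm]
    have h2 : ‖v i - v j‖ ^ 2 = 2 := by rw [h]; norm_num
    nlinarith [norm_nonneg (v i - v j)]
  have hdisj : Pairwise (Function.onFun Disjoint fun i => Metric.ball (v i) (1 / 2)) := by
    intro i j hij
    exact Metric.ball_disjoint_ball (by linarith [hdist i j hij])
  exact hdisj.countable_of_isOpen_disjoint (fun _ => Metric.isOpen_ball)
    (fun i => ⟨v i, Metric.mem_ball_self (by norm_num)⟩)

/-- Parseval's identity, as a sum in `[0, ∞]`. -/
theorem HilbertBasis.tsum_enorm_inner_sq {ι H : Type*} [NormedAddCommGroup H]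
    [InnerProductSpace ℂ H] (b : HilbertBasis ι ℂ H) (x : H) :
    ∑' i, ‖⟪b i, x⟫_ℂ‖ₑ ^ 2 = ‖x‖ₑ ^ 2 := by
  have h := b.hasSum_inner_mul_inner x x
  have hterm : ∀ i, ⟪x, b i⟫_ℂ * ⟪b i, x⟫_ℂ = ((‖⟪b i, x⟫_ℂ‖ ^ 2 : ℝ) : ℂ) := by
    intro i
    rw [← inner_conj_symm x, RCLike.conj_mul]
    norm_cast
  have hself : ⟪x, x⟫_ℂ = ((‖x‖ ^ 2 : ℝ) : ℂ) := by
    rw [inner_self_eq_norm_sq_to_K]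
    norm_cast
  simp_rw [hterm] at h
  rw [hself] at h
  have h' : HasSum (fun i => ‖⟪b i, x⟫_ℂ‖ ^ 2) (‖x‖ ^ 2) := Complex.hasSum_ofReal.1 h
  have := ENNReal.ofReal_tsum_of_nonneg (fun i => by positivity) h'.summable
  rw [h'.tsum_eq] at this
  simp only [← ofReal_norm, ← ENNReal.ofReal_pow (norm_nonneg _)]
  exact this.symm

/-- The Hilbert–Schmidt norm of an operator, computed in any basis of its source, is that of its
adjoint, computed in any basis of its target. -/
theorem tsum_enorm_adjoint_sq {ι κ E F : Type*} [NormedAddCommGroup E] [InnerProductSpace ℂ E]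
    [CompleteSpace E] [NormedAddCommGroup F] [InnerProductSpace ℂ F] [CompleteSpace F]
    (B : E →L[ℂ] F) (b : HilbertBasis ι ℂ E) (c : HilbertBasis κ ℂ F) :
    ∑' i, ‖B.adjoint (c i)‖ₑ ^ 2 = ∑' j, ‖B (b j)‖ₑ ^ 2 := by
  simp_rw [← b.tsum_enorm_inner_sq (B.adjoint _), ← c.tsum_enorm_inner_sq (B _)]
  rw [ENNReal.tsum_comm]
  refine tsum_congr fun j => tsum_congr fun i => ?_
  rw [ContinuousLinearMap.adjoint_inner_right, ← inner_conj_symm]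
  simp only [RCLike.enorm_conj]

/-! ### Feature maps of positive definite kernels -/

/-- A positive definite kernel is the Gram kernel of a family of vectors with dense span, namely of
the kernel functions in its reproducing kernel Hilbert space. -/
theorem IsPositiveDefiniteKernel.exists_featureMap {X : Type} {R : X → X → ℂ}
    (hR : IsPositiveDefiniteKernel R) :
    ∃ (H : Type) (_ : NormedAddCommGroup H) (_ : InnerProductSpace ℂ H) (_ : CompleteSpace H)
      (φ : X → H), (∀ x y, ⟪φ x, φ y⟫_ℂ = R x y) ∧
        (Submodule.span ℂ (Set.range φ)).topologicalClosure = ⊤ := by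
  -- Mathlib's kernels are operator valued: the number `R x y` becomes a multiple of the identity.
  let M : Matrix X X (ℂ →L[ℂ] ℂ) := Matrix.of fun x y => R x y • 1
  have hM : M.PosSemidef := by
    have hH : M.IsHermitian := by
      ext x y
      have := hR.1.apply x y
      simp only [Matrix.of_apply] at this
      simp [M, Matrix.conjTranspose_apply, ← this]
    have hpos := (RKHS.posSemidef_tfae (K := M)).out 0 2
    refine hpos.2 ⟨hH, fun v => ?_⟩
    refine (Complex.le_def.1 (hR.2 v)).1.trans_eq (congrArg Complex.re ?_)
    refine Finsupp.sum_congr fun x _ => Finsupp.sum_congr fun y _ => ?_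
    have := hR.1.apply x y
    simp only [Matrix.of_apply] at this
    simp [M, ← this]
    ring
  have : Fact M.PosSemidef := ⟨hM⟩
  refine ⟨RKHS.OfKernel M, inferInstance, inferInstance, inferInstance,
    fun x => RKHS.kerFun (RKHS.OfKernel M) x 1, fun x y => ?_, ?_⟩
  · rw [RKHS.kerFun_inner, RKHS.kerFun_apply, RKHS.OfKernel.kernel_ofKernel]
    simp [M]
  · rw [eq_top_iff, ← RKHS.kerFun_dense (RKHS.OfKernel M)]
    refine Submodule.topologicalClosure_mono (Submodule.span_le.2 ?_)
    rintro _ ⟨x, v, rfl⟩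
    have : RKHS.kerFun (RKHS.OfKernel M) x v = v • RKHS.kerFun (RKHS.OfKernel M) x 1 := by
      rw [← map_smul, smul_eq_mul, mul_one]
    rw [this]
    exact Submodule.smul_mem _ _ (Submodule.subset_span ⟨x, rfl⟩)

/-- Continuity of the Gram kernel suffices, because it determines the distances:
`‖φ y - φ x‖² = ⟪φ y, φ y⟫ - ⟪φ y, φ x⟫ - ⟪φ x, φ y⟫ + ⟪φ x, φ x⟫`. -/
theorem continuous_of_continuous_gram {X H : Type*} [TopologicalSpace X] [NormedAddCommGroup H]
    [InnerProductSpace ℂ H] {φ : X → H}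
    (h : Continuous fun p : X × X => ⟪φ p.1, φ p.2⟫_ℂ) : Continuous φ := by
  refine continuous_iff_continuousAt.2 fun x => tendsto_iff_norm_sub_tendsto_zero.2 ?_
  have hsq : Continuous fun y => ‖φ y - φ x‖ ^ 2 := by
    have : (fun y => ‖φ y - φ x‖ ^ 2) =
        fun y => (⟪φ y, φ y⟫_ℂ - ⟪φ y, φ x⟫_ℂ - ⟪φ x, φ y⟫_ℂ + ⟪φ x, φ x⟫_ℂ).re := by
      ext y
      rw [← inner_sub_sub_self, inner_self_eq_norm_sq_to_K]
      norm_cast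
    rw [this]
    have h1 : Continuous fun y => ⟪φ y, φ y⟫_ℂ := h.comp (continuous_id.prodMk continuous_id)
    have h2 : Continuous fun y => ⟪φ y, φ x⟫_ℂ := h.comp (continuous_id.prodMk continuous_const)
    have h3 : Continuous fun y => ⟪φ x, φ y⟫_ℂ := h.comp (continuous_const.prodMk continuous_id)
    fun_prop
  have := (hsq.sqrt).tendsto x
  simpa [Real.sqrt_sq] using this

theorem separableSpace_of_dense_span_range {X H : Type*} [TopologicalSpace X]
    [TopologicalSpace.SeparableSpace X] [NormedAddCommGroup H] [InnerProductSpace ℂ H] {φ : X → H}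
    (hφ : Continuous φ) (hd : (Submodule.span ℂ (Set.range φ)).topologicalClosure = ⊤) :
    TopologicalSpace.SeparableSpace H := by
  have h := ((TopologicalSpace.isSeparable_range hφ).span (R := ℂ)).closure
  rw [← Submodule.topologicalClosure_coe, hd] at h
  exact TopologicalSpace.isSeparable_univ_iff.1 h

/-! ### The analysis operator of a square integrable family -/

section Analysis

variable {X : Type*} [MeasurableSpace X] {μ : Measure X} {H : Type*} [NormedAddCommGroup H]
  [InnerProductSpace ℂ H]

theorem MeasureTheory.MemLp.inner_const_right {g : X → H} (hg : MemLp g 2 μ) (h : H) :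
    MemLp (fun s => ⟪g s, h⟫_ℂ) 2 μ :=
  hg.of_le_mul (c := ‖h‖) (hg.1.inner aestronglyMeasurable_const)
    (.of_forall fun _ => (norm_inner_le_norm _ _).trans_eq (mul_comm _ _))

/-- The analysis operator `h ↦ ⟪g ·, h⟫` of a square integrable family of vectors `g`. -/
noncomputable def analysisOperator (g : X → H) (hg : MemLp g 2 μ) : H →L[ℂ] Lp ℂ 2 μ :=
  LinearMap.mkContinuous
    { toFun := fun h => (hg.inner_const_right h).toLp _
      map_add' := fun h h' => by
        rw [← MemLp.toLp_add]
        exact MemLp.toLp_congr _ _ (.of_forall fun _ => inner_add_right _ _ _)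
      map_smul' := fun _ h => by
        rw [RingHom.id_apply, ← MemLp.toLp_const_smul]
        exact MemLp.toLp_congr _ _ (.of_forall fun _ => inner_smul_right _ _ _) }
    ‖hg.toLp g‖ fun h => by
      rw [mul_comm]
      refine Lp.norm_le_mul_norm_of_ae_le_mul ?_
      filter_upwards [MemLp.coeFn_toLp (hg.inner_const_right h), hg.coeFn_toLp] with s h1 h2
      simp only [LinearMap.coe_mk, AddHom.coe_mk]
      rw [h1, h2, mul_comm]
      exact norm_inner_le_norm _ _

theorem analysisOperator_ae_eq {g : X → H} (hg : MemLp g 2 μ) (h : H) :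
    analysisOperator g hg h =ᵐ[μ] fun s => ⟪g s, h⟫_ℂ :=
  MemLp.coeFn_toLp (hg.inner_const_right h)

theorem enorm_analysisOperator_sq {g : X → H} (hg : MemLp g 2 μ) (h : H) :
    ‖analysisOperator g hg h‖ₑ ^ 2 = ∫⁻ s, ‖⟪h, g s⟫_ℂ‖ₑ ^ 2 ∂μ := by
  rw [Lp.enorm_def, ← ENNReal.rpow_natCast, eLpNorm_congr_ae (analysisOperator_ae_eq hg h),
    eLpNorm_eq_lintegral_rpow_enorm_toReal (by norm_num) (by norm_num), ← ENNReal.rpow_mul]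
  simp only [ENNReal.toReal_ofNat, Nat.cast_ofNat, one_div, ne_eq, OfNat.ofNat_ne_zero,
    not_false_eq_true, inv_mul_cancel₀, ENNReal.rpow_one]
  refine lintegral_congr fun s => ?_
  rw [← inner_conj_symm, RCLike.enorm_conj, ← ENNReal.rpow_natCast]
  rfl

variable [CompleteSpace H]

/-- With `A` the analysis operator of `g`, the operator `A A*` has kernel `⟪g s, g t⟫`, because
`(A A* f)(s) = ⟪g s, A* f⟫ = ⟪A (g s), f⟫`. -/
theorem isIntegralOperator_analysisOperator_comp_adjoint {g : X → H} (hg : MemLp g 2 μ)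
    {k : X → X → ℂ} (hk : ∀ s t, k s t = ⟪g s, g t⟫_ℂ) :
    IsIntegralOperator k (analysisOperator g hg ∘L (analysisOperator g hg).adjoint) := by
  intro f
  filter_upwards [analysisOperator_ae_eq hg ((analysisOperator g hg).adjoint f)] with s hs
  have hae : (fun t => ⟪analysisOperator g hg (g s) t, f t⟫_ℂ) =ᵐ[μ] fun t => k s t * f t := by
    filter_upwards [analysisOperator_ae_eq hg (g s)] with t ht
    rw [ht, hk, RCLike.inner_apply, inner_conj_symm, mul_comm]
  refine ⟨(L2.integrable_inner (𝕜 := ℂ) _ f).congr hae, ?_⟩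
  rw [ContinuousLinearMap.comp_apply, hs, ContinuousLinearMap.adjoint_inner_right, L2.inner_def]
  exact integral_congr_ae hae

/-- The squared Hilbert–Schmidt norm of the adjoint of the analysis operator of `g` is the squared
`L²` norm of `g`. Separability is used to sum over a countable basis of `H` under the integral. -/
theorem tsum_enorm_adjoint_analysisOperator_sq [TopologicalSpace.SeparableSpace H] {g : X → H}
    (hg : MemLp g 2 μ) {ι : Type*} (c : HilbertBasis ι ℂ (Lp ℂ 2 μ)) :
    ∑' i, ‖(analysisOperator g hg).adjoint (c i)‖ₑ ^ 2 = ∫⁻ s, ‖g s‖ₑ ^ 2 ∂μ := by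
  obtain ⟨w, b, -⟩ := exists_hilbertBasis ℂ H
  have : Countable w := b.orthonormal.countable_of_separableSpace
  rw [tsum_enorm_adjoint_sq _ b c]
  simp_rw [enorm_analysisOperator_sq]
  rw [← lintegral_tsum fun j =>
    ((aestronglyMeasurable_const.inner hg.1).enorm.pow_const 2)]
  simp_rw [b.tsum_enorm_inner_sq]

end Analysis

/-! ### Trace and trace norm of `A A*` -/

section Trace

variable {H E : Type*} [NormedAddCommGroup H] [InnerProductSpace ℂ H] [CompleteSpace H]
  [NormedAddCommGroup E] [InnerProductSpace ℂ E] [CompleteSpace E]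

/-- The diagonal entries of `A A*` are real, so that its trace reduces to a sum of nonnegative
numbers. -/
theorem inner_comp_adjoint_self (A : E →L[ℂ] H) (x : H) :
    ⟪x, (A ∘L A.adjoint) x⟫_ℂ = ((‖A.adjoint x‖ ^ 2 : ℝ) : ℂ) := by
  rw [ContinuousLinearMap.comp_apply, ← ContinuousLinearMap.adjoint_inner_left,
    inner_self_eq_norm_sq_to_K, Complex.ofReal_pow]
  rfl

theorem hasTrace_comp_adjoint {A : E →L[ℂ] H} {τ : ℝ} (hτ : 0 ≤ τ)
    (hA : ∀ (w : Set H) (b : HilbertBasis w ℂ H),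
      ∑' i, ‖A.adjoint (b i)‖ₑ ^ 2 = ENNReal.ofReal τ) :
    HasTrace (A ∘L A.adjoint) (τ : ℂ) := by
  intro w b
  simp_rw [inner_comp_adjoint_self]
  rw [Complex.hasSum_ofReal]
  have h := hA w b
  simp only [← ofReal_norm, ← ENNReal.ofReal_pow (norm_nonneg _)] at h
  have hs := ENNReal.summable_toReal (h.trans_ne ENNReal.ofReal_ne_top)
  have hr : ∀ i, (ENNReal.ofReal (‖A.adjoint (b i)‖ ^ 2)).toReal = ‖A.adjoint (b i)‖ ^ 2 :=
    fun i => ENNReal.toReal_ofReal (by positivity)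
  have ht := congrArg ENNReal.toReal h
  rw [ENNReal.tsum_toReal_eq fun i => ENNReal.ofReal_ne_top, ENNReal.toReal_ofReal hτ] at ht
  simp_rw [hr] at hs ht
  exact ht ▸ hs.hasSum

theorem traceNorm_comp_adjoint {A : E →L[ℂ] H} {τ : ℝ≥0∞}
    (hA : ∀ (w : Set H) (b : HilbertBasis w ℂ H), ∑' i, ‖A.adjoint (b i)‖ₑ ^ 2 = τ) :
    traceNorm (A ∘L A.adjoint) = τ := by
  have habs : CFC.abs (A ∘L A.adjoint) = A ∘L A.adjoint :=
    CFC.abs_of_nonneg _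
      ((ContinuousLinearMap.nonneg_iff_isPositive _).2
        (ContinuousLinearMap.isPositive_self_comp_adjoint A))
  have h : ∀ (w : Set H) (b : HilbertBasis w ℂ H),
      ∑' i, ENNReal.ofReal (⟪b i, CFC.abs (A ∘L A.adjoint) (b i)⟫_ℂ).re = τ := by
    intro w b
    rw [habs, ← hA w b]
    refine tsum_congr fun i => ?_
    rw [inner_comp_adjoint_self, Complex.ofReal_re, ENNReal.ofReal_pow (norm_nonneg _),
      ofReal_norm]
  obtain ⟨w, b, -⟩ := exists_hilbertBasis ℂ H
  exact le_antisymm (iSup₂_le fun w b => (h w b).le) <|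
    (h w b).ge.trans (le_iSup₂_of_le w b le_rfl)

end Trace

theorem mainTheorem6 (q : ℝ → ℝ) (R : ℝ → ℝ → ℂ)
    (hq_nonneg : ∀ᵐ x, 0 ≤ q x) (hq_one : MemLp q 1) (hq_two : MemLp q 2)
    (hR_cont : Continuous (fun p : ℝ × ℝ => R p.1 p.2))
    (hR_pos : IsPositiveDefiniteKernel R)
    (hqR : Integrable (fun x => q x * (R x x).re)) :
    ∃ K : Lp ℂ 2 (volume : Measure ℝ) →L[ℂ] Lp ℂ 2 (volume : Measure ℝ),
      IsIntegralOperator (fun s t => (Real.sqrt (q s) : ℂ) * R s t * (Real.sqrt (q t) : ℂ)) K ∧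
      K.IsPositive ∧
      IsTraceClass K ∧
      ∃ τ : ℝ, HasTrace K (τ : ℂ) ∧ traceNorm K = ENNReal.ofReal τ ∧
        τ = ∫ x, q x * (R x x).re := by
  obtain ⟨H, _, _, _, φ, hφ, hdense⟩ := hR_pos.exists_featureMap
  have hφ_cont : Continuous φ := continuous_of_continuous_gram (by simpa only [hφ] using hR_cont)
  have : TopologicalSpace.SeparableSpace H := separableSpace_of_dense_span_range hφ_cont hdense
  let g : ℝ → H := fun s => (Real.sqrt (q s) : ℂ) • φ s
  have hg_norm : (fun s => ‖g s‖ ^ 2) =ᵐ[volume] fun s => q s * (R s s).re := by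
    filter_upwards [hq_nonneg] with s hs
    have h : (R s s).re = ‖φ s‖ ^ 2 := by
      rw [← hφ, inner_self_eq_norm_sq_to_K, ← Complex.ofReal_re (‖φ s‖ ^ 2), Complex.ofReal_pow]
      rfl
    rw [norm_smul, mul_pow, Complex.norm_real, Real.norm_eq_abs, sq_abs, Real.sq_sqrt hs, h]
  have hg_meas : AEStronglyMeasurable g volume :=
    (Complex.continuous_ofReal.comp Real.continuous_sqrt).comp_aestronglyMeasurable hq_one.1
      |>.smul hφ_cont.aestronglyMeasurable
  have hg : MemLp g 2 := (memLp_two_iff_integrable_sq_norm hg_meas).2 (hqR.congr hg_norm.symm)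
  have hτ : ∫⁻ s, ‖g s‖ₑ ^ 2 = ENNReal.ofReal (∫ x, q x * (R x x).re) := by
    rw [← integral_congr_ae hg_norm, ofReal_integral_eq_lintegral_ofReal
      (hqR.congr hg_norm.symm) (.of_forall fun s => by positivity)]
    refine lintegral_congr fun s => ?_
    rw [ENNReal.ofReal_pow (norm_nonneg _), ofReal_norm]
  have hτ_nonneg : 0 ≤ ∫ x, q x * (R x x).re := by
    rw [← integral_congr_ae hg_norm]
    exact integral_nonneg fun s => by positivity
  have hsum := fun (w : Set (Lp ℂ 2 (volume : Measure ℝ)))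
    (b : HilbertBasis w ℂ (Lp ℂ 2 (volume : Measure ℝ))) =>
    (tsum_enorm_adjoint_analysisOperator_sq hg b).trans hτ
  have hnorm := traceNorm_comp_adjoint hsum
  refine ⟨_, isIntegralOperator_analysisOperator_comp_adjoint hg fun s t => ?_,
    ContinuousLinearMap.isPositive_self_comp_adjoint _, ?_, _,
    hasTrace_comp_adjoint hτ_nonneg hsum, hnorm, rfl⟩
  · rw [inner_smul_left, inner_smul_right, hφ, Complex.conj_ofReal]
    ring
  · rw [IsTraceClass, hnorm]
    exact ENNReal.ofReal_lt_top
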